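/- Let $\alpha>0$, let $X_1,X_2,\dots$ be i.i.d. $\alpha$-Pareto random variables, $\mathbb P(X_i>x)=x^{-\alpha}$ for $x\ge 1$, and let $X_{(1)}\le\dots\le X_{(n)}$ be the order statistics of $X_1,\dots,X_n$. Fix an integer $k\ge 1$ and, for $n\ge k$, let $T_k=\sum_{j=1}^{n-k}X_{(j)}$ be the sum of the $n-k$ smallest ones. For $y>1$, let $\mathcal L(T_k\mid X_{(n-k+1)}=y)$ denote the weak limit, as $\varepsilon\downarrow 0$, of the law of $T_k$ conditioned on the event $|X_{(n-k+1)}-y|\le\varepsilon$. Then the following hold. (1) For every $n\ge k$ and every $y>1$, the law $\mathcal L(T_k\mid X_{(n-k+1)}=y)$ exists and is the law of $Y_1+\dots+Y_{n-k}$, where the $Y_j$ are i.i.d. with the $\alpha$-Pareto law conditioned on $[1,y]$. For almost every $y$ with respect to the law of $X_{(n-k+1)}$, it coincides with the regular conditional distribution of $T_k$ given $X_{(n-k+1)}$. (2) For every $n\ge k$ and $y>1$, this law has a finite second moment, and its mean and variance are $$m_1(\alpha,n,k,y)=\frac{n-k}{1-y^{-\alpha}}\times\begin{cases}\dfrac{1-y^{1-\alpha}}{1-1/\alpha}&\text{if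 }\alpha\ne1,\\[2mm] \ln y&\text{if }\alpha=1,\end{cases}$$ $$\sigma^2(\alpha,n,k,y)=\begin{cases}(n-k)\,y\left(1-\dfrac{y\ln^2 y}{(y-1)^2}\right)&\text{if }\alpha=1,\\[3mm] 2(n-k)\dfrac{y^2}{y^2-1}\left(\ln y-2\,\dfrac{y-1}{y+1}\right)&\text{if }\alpha=2,\\[3mm] \dfrac{n-k}{1-y^{-\alpha}}\left(\dfrac{1-y^{2-\alpha}}{1-2/\alpha}-\dfrac{1}{(1-1/\alpha)^2}\,\dfrac{(1-y^{1-\alpha})^2}{1-y^{-\alpha}}\right)&\text{if }\alpha\ne1,2,\end{cases}$$ and $\sigma^2(\alpha,n,k,y)>0$ when $n>k$. (3) For every $y>1$, as $n\to\infty$ with $k$ and $y$ fixed, $\mathcal L(T_k\mid X_{(n-k+1)}=y)$ is asymptotically $\mathcal N\big(m_1(\alpha,n,k,y),\sigma^2(\alpha,n,k,y)\big)$: under this conditional law, $(T_k-m_1)/\sigma$ converges in distribution to $\mathcal N(0,1)$, and the supremum over $x\in\mathbb R$ of the absolute difference between the distribution functions of $\mathcal L(T_k\mid X_{(n-k+1)}=y)$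 and of $\mathcal N(m_1,\sigma^2)$ tends to $0$. -/

import Mathlib

open MeasureTheory ProbabilityTheory Filter Topology Set
open scoped BoundedContinuousFunction

noncomputable section

/-- The `j`-th smallest (`1 ≤ j ≤ n`) among the first `n` variables `X 0 ω, …, X (n-1) ω` of a
sequence; the value outside the range `1 ≤ j ≤ n` is irrelevant. -/
def orderStat {Ω : Type*} (X : ℕ → Ω → ℝ) (n j : ℕ) (ω : Ω) : ℝ :=
  if h : 1 ≤ j ∧ j ≤ n then
    (fun i : Fin n => X i ω) (Tuple.sort (fun i : Fin n => X i ω) ⟨j - 1, by omega⟩)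
  else 0

/-- The trimmed sum `T_k`: the sum of the `n - k` smallest order statistics. -/
def trimmedSum {Ω : Type*} (X : ℕ → Ω → ℝ) (n k : ℕ) (ω : Ω) : ℝ :=
  ∑ j ∈ Finset.Icc 1 (n - k), orderStat X n j ω

/-- The `α`-Pareto law on `[1, ∞)` (with cdf `1 - x ^ (-α)`) conditioned on `[1, y]`. -/
def truncPareto (α y : ℝ) : Measure ℝ :=
  ProbabilityTheory.cond (paretoMeasure 1 α) (Icc 1 y)

/-- The law of `Y_1 + ⋯ + Y_m` for `Y_1, …, Y_m` independent with law `truncPareto α y`. -/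
def truncParetoSumLaw (α y : ℝ) (m : ℕ) : Measure ℝ :=
  (Measure.pi (fun _ : Fin m => truncPareto α y)).map (fun v => ∑ i, v i)

/-- `ν` is the conditional law of `T` given `Z = y` at the point `y` of the support of `Z`: the
elementary conditional laws of `T` given `|Z - y| ≤ ε` converge weakly to `ν` as `ε ↓ 0`. -/
def IsCondLawAt {Ω : Type*} [MeasurableSpace Ω] (P : Measure Ω) (T Z : Ω → ℝ) (y : ℝ)
    (ν : Measure ℝ) : Prop :=
  IsProbabilityMeasure ν ∧
  (∀ ε : ℝ, 0 < ε → P (Z ⁻¹' Icc (y - ε) (y + ε)) ≠ 0) ∧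
  ∀ f : ℝ →ᵇ ℝ,
    Tendsto (fun ε : ℝ => ∫ ω, f (T ω) ∂(ProbabilityTheory.cond P (Z ⁻¹' Icc (y - ε) (y + ε))))
      (𝓝[>] 0) (𝓝 (∫ t, f t ∂ν))

open Classical in
/-- The mean `m_1(α, n, k, y)`. -/
def trimmedMean (α : ℝ) (n k : ℕ) (y : ℝ) : ℝ :=
  ((n : ℝ) - k) / (1 - y ^ (-α)) *
    (if α = 1 then Real.log y else (1 - y ^ (1 - α)) / (1 - 1 / α))

open Classical in
/-- The variance `σ²(α, n, k, y)`. -/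
def trimmedVar (α : ℝ) (n k : ℕ) (y : ℝ) : ℝ :=
  if α = 1 then
    ((n : ℝ) - k) * y * (1 - y * Real.log y ^ 2 / (y - 1) ^ 2)
  else if α = 2 then
    2 * ((n : ℝ) - k) * (y ^ 2 / (y ^ 2 - 1)) * (Real.log y - 2 * ((y - 1) / (y + 1)))
  else
    ((n : ℝ) - k) / (1 - y ^ (-α)) *
      ((1 - y ^ (2 - α)) / (1 - 2 / α)
        - 1 / (1 - 1 / α) ^ 2 * ((1 - y ^ (1 - α)) ^ 2 / (1 - y ^ (-α))))

end

/-!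
The order statistics of an iid sample from an atomless law `μ` have `n!` times the restriction of
`μ^n` to the cone of strictly increasing vectors as their joint law. Splitting that cone at the
`(m + 1)`-th entry `z` leaves a cone of `m` entries below `z` and one of `n - m - 1` entries above
it, and the sum over a cone is, up to the factorial, the sum over the whole box. Hence the pair
formed by the `(m + 1)`-th order statistic and the sum of the `m` smaller ones disintegrates into a
density in `z` and the kernel sending `z` to the law of a sum of `m` independent variables with law
`μ` conditioned on `(-∞, z]`. That kernel is weakly continuous in `z`, so averaging it over
shrinking intervals around `y` identifies the weak limit as its value at `y`. What remains is the
central limit theorem for iid sums, made uniform by monotonicity of distribution functions (Pólya),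
and the first two moments of the truncated Pareto law.
-/

section SortedVectors

variable {β : Type*} [LinearOrder β] {n : ℕ}

/-- The vector of order statistics of `v`: its entries in nondecreasing order, indexed from `0`. -/
def sortVec (v : Fin n → β) : Fin n → β := v ∘ Tuple.sort v

lemma sortVec_comp_perm (v : Fin n → β) (σ : Equiv.Perm (Fin n)) : sortVec (v ∘ σ) = sortVec v :=
  Tuple.comp_perm_comp_sort_eq_comp_sort

lemma sortVec_of_monotone {v : Fin n → β} (hv : Monotone v) : sortVec v = v := by
  rw [sortVec, Tuple.sort_eq_refl_iff_monotone.2 hv, Equiv.coe_refl, Function.comp_id]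

lemma sortVec_of_monotone_comp {v : Fin n → β} {σ : Equiv.Perm (Fin n)} (hv : Monotone (v ∘ σ)) :
    sortVec v = v ∘ σ := by
  rw [← sortVec_comp_perm v σ, sortVec_of_monotone hv]

lemma strictMono_sortVec {v : Fin n → β} (hv : Function.Injective v) : StrictMono (sortVec v) :=
  (Tuple.monotone_sort v).strictMono_of_injective (hv.comp (Tuple.sort v).injective)

lemma sum_sortVec [AddCommMonoid β] (v : Fin n → β) : ∑ i, sortVec v i = ∑ i, v i :=
  Equiv.sum_comp (Tuple.sort v) v

lemma sortVec_le_iff (v : Fin n → β) (j : Fin n) (a : β) :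
    sortVec v j ≤ a ↔ (j : ℕ) < (Finset.univ.filter fun i => v i ≤ a).card := by
  have hcard : (Finset.univ.filter fun i => sortVec v i ≤ a).card
      = (Finset.univ.filter fun i => v i ≤ a).card :=
    Finset.card_equiv (Tuple.sort v) fun i => by
      rw [Finset.mem_filter_univ, Finset.mem_filter_univ]
      rfl
  rw [← hcard]
  exact (Tuple.lt_card_le_iff_apply_le_of_monotone (Tuple.monotone_sort v)).symm

variable [TopologicalSpace β] [OrderTopology β] [SecondCountableTopology β] [MeasurableSpace β]
  [BorelSpace β]

lemma measurable_sortVec : Measurable (sortVec : (Fin n → β) → Fin n → β) := by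
  refine measurable_pi_lambda _ fun j => measurable_of_Iic fun a => ?_
  have hcount : Measurable fun v : Fin n → β => ∑ i, if v i ≤ a then (1 : ℕ) else 0 :=
    Finset.measurable_fun_sum _ fun i _ =>
      Measurable.ite (measurableSet_le (measurable_pi_apply i) measurable_const)
        measurable_const measurable_const
  have hset : (fun v : Fin n → β => sortVec v j) ⁻¹' Iic a
      = {v | (j : ℕ) < ∑ i, if v i ≤ a then (1 : ℕ) else 0} := by
    ext v
    simp [sortVec_le_iff]
  rw [hset]
  exact measurableSet_lt measurable_const hcount

lemma measurableSet_strictMono : MeasurableSet {v : Fin n → β | StrictMono v} := by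
  simp only [StrictMono, ofPred_forall]
  exact .iInter fun i => .iInter fun j => .iInter fun _ =>
    measurableSet_lt (measurable_pi_apply i) (measurable_pi_apply j)

end SortedVectors

section Symmetrization

lemma measurePreserving_comp_perm {ι β : Type*} [Fintype ι] [MeasurableSpace β] (μ : Measure β)
    [SigmaFinite μ] (σ : Equiv.Perm ι) :
    MeasurePreserving (fun v : ι → β => v ∘ σ) (Measure.pi fun _ => μ) (Measure.pi fun _ => μ) := by
  convert measurePreserving_piCongrLeft (fun _ : ι => μ) σ.symm using 1
  ext v i
  simpa using (MeasurableEquiv.piCongrLeft_apply_apply (β := fun _ : ι => β) σ.symm v (σ i)).symm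

variable {β : Type*} [LinearOrder β] [TopologicalSpace β] [OrderTopology β]
  [SecondCountableTopology β] [MeasurableSpace β] [BorelSpace β] {n : ℕ}
  (μ : Measure β) [SigmaFinite μ] [NullSingletonClass μ]

lemma ae_injective_pi : ∀ᵐ v ∂Measure.pi fun _ : Fin n => μ, Function.Injective v := by
  simp only [Function.Injective, ae_all_iff]
  intro i j
  rcases n with _ | n
  · exact i.elim0
  rcases Fin.eq_self_or_eq_succAbove i j with rfl | ⟨j, rfl⟩
  · exact ae_of_all _ fun _ _ => rfl
  have hdiag : ∀ᵐ q : β × (Fin n → β) ∂μ.prod (Measure.pi fun _ => μ), q.1 ≠ q.2 j := by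
    have hmeas : MeasurableSet {q : β × (Fin n → β) | q.1 ≠ q.2 j} :=
      (measurableSet_eq_fun measurable_fst (by fun_prop)).compl
    exact (Measure.ae_prod_mem_iff_ae_ae_mem hmeas).2
      (ae_of_all _ fun x => (Measure.ae_eval_ne (fun _ => μ) j x).mono fun _ h => h.symm)
  filter_upwards [(measurePreserving_piFinSuccAbove (fun _ => μ) i).quasiMeasurePreserving.ae
    hdiag] with v hv h using absurd h hv

lemma map_sortVec_pi :
    (Measure.pi fun _ : Fin n => μ).map sortVec
      = (n.factorial : ENNReal) • (Measure.pi fun _ => μ).restrict {v | StrictMono v} := by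
  ext s hs
  have hA : MeasurableSet ({v : Fin n → β | StrictMono v} ∩ s) := measurableSet_strictMono.inter hs
  have hperm (σ : Equiv.Perm (Fin n)) := measurePreserving_comp_perm μ σ
  have hae : sortVec ⁻¹' s =ᵐ[Measure.pi fun _ : Fin n => μ]
      ⋃ σ : Equiv.Perm (Fin n), (fun v => v ∘ σ) ⁻¹' ({v | StrictMono v} ∩ s) := by
    filter_upwards [ae_injective_pi μ] with v hv
    refine propext ⟨fun h => mem_iUnion.2 ⟨Tuple.sort v, strictMono_sortVec hv, h⟩, fun h => ?_⟩
    obtain ⟨σ, hσ, hs⟩ := mem_iUnion.1 h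
    exact (congrArg (· ∈ s) (sortVec_of_monotone_comp hσ.monotone)).mpr hs
  have hdisj : Pairwise (Function.onFun Disjoint fun σ : Equiv.Perm (Fin n) =>
      (fun v : Fin n → β => v ∘ σ) ⁻¹' ({v | StrictMono v} ∩ s)) := by
    refine fun σ τ hστ => Set.disjoint_left.2 fun v hσ hτ => hστ ?_
    have hcomp := (sortVec_of_monotone_comp hσ.1.monotone).symm.trans
      (sortVec_of_monotone_comp hτ.1.monotone)
    have hinj : Function.Injective v := by
      simpa using hσ.1.injective.comp σ.symm.injective
    exact DFunLike.coe_injective (hinj.comp_left hcomp)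
  rw [Measure.map_apply measurable_sortVec hs, measure_congr hae,
    measure_iUnion hdisj fun σ => (hperm σ).measurable hA, tsum_fintype]
  simp only [(hperm _).measure_preimage hA.nullMeasurableSet, Finset.sum_const, Finset.card_univ,
    Fintype.card_perm, Fintype.card_fin, Measure.smul_apply, Measure.restrict_apply hs,
    nsmul_eq_mul, smul_eq_mul, Set.inter_comm s]

lemma lintegral_comp_sortVec {F : (Fin n → β) → ENNReal} (hF : Measurable F) :
    ∫⁻ v, F (sortVec v) ∂Measure.pi (fun _ => μ)
      = n.factorial * ∫⁻ v in {v | StrictMono v}, F v ∂Measure.pi (fun _ => μ) := by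
  rw [← lintegral_map hF measurable_sortVec, map_sortVec_pi, lintegral_smul_measure, smul_eq_mul]

lemma factorial_mul_pi_strictMono :
    n.factorial * Measure.pi (fun _ : Fin n => μ) {v | StrictMono v} = μ univ ^ n := by
  simpa [Measure.pi_univ] using (lintegral_comp_sortVec (n := n) μ measurable_one).symm

lemma factorial_mul_setLIntegral_strictMono_sum [AddCommMonoid β] [MeasurableAdd₂ β]
    {g : β → ENNReal} (hg : Measurable g) :
    n.factorial * ∫⁻ v in {v | StrictMono v}, g (∑ i, v i) ∂Measure.pi (fun _ : Fin n => μ)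
      = ∫⁻ v, g (∑ i, v i) ∂Measure.pi (fun _ : Fin n => μ) := by
  rw [← lintegral_comp_sortVec μ (F := fun v => g (∑ i, v i)) (by fun_prop)]
  simp only [sum_sortVec]

end Symmetrization

section Splitting

variable {β : Type*} {m l : ℕ}

/-- The position in `Fin (m + 1 + l)` with `m` predecessors and `l` successors. -/
def midIndex (m l : ℕ) : Fin (m + 1 + l) := Fin.castAdd l (Fin.natAdd m 0)

/-- The first `m` entries of a vector with `m + 1 + l` entries. -/
def headVec (v : Fin (m + 1 + l) → β) (i : Fin m) : β := v (Fin.castAdd l (Fin.castAdd 1 i))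

/-- The vector with first entries `q.2.1`, then the entry `q.1`, then the entries `q.2.2`. -/
def joinVec (q : β × (Fin m → β) × (Fin l → β)) : Fin (m + 1 + l) → β :=
  Fin.append (Fin.append q.2.1 fun _ : Fin 1 => q.1) q.2.2

lemma strictMono_joinVec_iff [LinearOrder β] (z : β) (a : Fin m → β) (b : Fin l → β) :
    StrictMono (joinVec (z, a, b)) ↔
      (StrictMono a ∧ ∀ i, a i < z) ∧ (StrictMono b ∧ ∀ j, z < b j) := by
  simp only [StrictMono, joinVec, Fin.forall_fin_add, Fin.append_left, Fin.append_right,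
    Fin.lt_def, Fin.val_castAdd, Fin.val_natAdd, Fin.forall_fin_one]
  grind

lemma joinVec_midIndex (z : β) (a : Fin m → β) (b : Fin l → β) :
    joinVec (z, a, b) (midIndex m l) = z := by
  simp [joinVec, midIndex]

lemma headVec_joinVec (z : β) (a : Fin m → β) (b : Fin l → β) :
    headVec (joinVec (z, a, b)) = a := by
  ext i
  simp [joinVec, headVec]

lemma indicator_strictMono_joinVec [LinearOrder β] (F : β → (Fin m → β) → ENNReal) (z : β)
    (a : Fin m → β) (b : Fin l → β) :
    {v | StrictMono v}.indicator (fun v => F (v (midIndex m l)) (headVec v)) (joinVec (z, a, b))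
      = ({a | StrictMono a} ∩ univ.pi fun _ => Iio z).indicator (F z) a
        * ({b | StrictMono b} ∩ univ.pi fun _ => Ioi z).indicator 1 b := by
  set A := {a : Fin m → β | StrictMono a} ∩ univ.pi fun _ => Iio z
  set B := {b : Fin l → β | StrictMono b} ∩ univ.pi fun _ => Ioi z
  have hmem : joinVec (z, a, b) ∈ {v | StrictMono v} ↔ a ∈ A ∧ b ∈ B := by
    simp only [A, B, mem_inter_iff, mem_univ_pi]
    exact strictMono_joinVec_iff z a b
  by_cases ha : a ∈ A <;> by_cases hb : b ∈ B <;>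
    simp [indicator, hmem, ha, hb, joinVec_midIndex, headVec_joinVec]

variable [MeasurableSpace β] (μ : Measure β) [SigmaFinite μ]

lemma measurePreserving_joinVec :
    MeasurePreserving joinVec
      (μ.prod ((Measure.pi fun _ : Fin m => μ).prod (Measure.pi fun _ : Fin l => μ)))
      (Measure.pi fun _ : Fin (m + 1 + l) => μ) := by
  have hmeas : Measurable (joinVec : β × (Fin m → β) × (Fin l → β) → Fin (m + 1 + l) → β) := by
    refine measurable_pi_lambda _ ?_
    simp only [Fin.forall_fin_add, joinVec, Fin.append_left, Fin.append_right]
    exact ⟨⟨fun _ => by fun_prop, fun _ => by fun_prop⟩, fun i => by fun_prop⟩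
  refine ⟨hmeas, (Measure.pi_eq fun s hs => ?_).symm⟩
  have hbox : (joinVec : β × (Fin m → β) × (Fin l → β) → _) ⁻¹' univ.pi s
      = s (midIndex m l) ×ˢ ((univ.pi fun i => s (Fin.castAdd l (Fin.castAdd 1 i))) ×ˢ
          (univ.pi fun i => s (Fin.natAdd (m + 1) i))) := by
    ext q
    simp only [joinVec, midIndex, mem_preimage, mem_univ_pi, Fin.forall_fin_add, Fin.append_left,
      Fin.append_right, mem_prod, Fin.forall_fin_one]
    tauto
  rw [Measure.map_apply hmeas (MeasurableSet.univ_pi hs), hbox, Measure.prod_prod,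
    Measure.prod_prod, Measure.pi_pi, Measure.pi_pi, Fin.prod_univ_add, Fin.prod_univ_add,
    Fin.prod_univ_one, midIndex]
  ring

variable [LinearOrder β] [TopologicalSpace β] [OrderTopology β] [SecondCountableTopology β]
  [BorelSpace β]

lemma setLIntegral_strictMono_eq_lintegral_mul {F : β → (Fin m → β) → ENNReal}
    (hF : Measurable (Function.uncurry F)) :
    ∫⁻ v in {v | StrictMono v}, F (v (midIndex m l)) (headVec v)
        ∂Measure.pi (fun _ : Fin (m + 1 + l) => μ)
      = ∫⁻ z, (∫⁻ a in {a | StrictMono a}, F z a ∂Measure.pi fun _ => μ.restrict (Iio z))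
          * Measure.pi (fun _ : Fin l => μ.restrict (Ioi z)) {b | StrictMono b} ∂μ := by
  have hSM (n : ℕ) := measurableSet_strictMono (β := β) (n := n)
  have hG := (Measurable.comp
    (f := fun v : Fin (m + 1 + l) → β => (v (midIndex m l), headVec v)) hF
    ((measurable_pi_apply _).prodMk
      (measurable_pi_lambda _ fun i => measurable_pi_apply _))).indicator (hSM _)
  have hjoin := measurePreserving_joinVec (m := m) (l := l) μ
  refine (lintegral_indicator (hSM _) _).symm.trans ((hjoin.lintegral_comp hG).symm.trans
    ((lintegral_prod _ (hG.comp hjoin.measurable).aemeasurable).trans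
      (lintegral_congr fun z => ?_)))
  have hA := (hSM m).inter (.univ_pi fun _ => measurableSet_Iio (a := z))
  have hB := (hSM l).inter (.univ_pi fun _ => measurableSet_Ioi (a := z))
  refine (lintegral_congr fun q : (Fin m → β) × (Fin l → β) =>
    indicator_strictMono_joinVec F z q.1 q.2).trans ?_
  have hFz : Measurable (F z) := hF.comp measurable_prodMk_left
  rw [lintegral_prod_mul (hFz.indicator hA).aemeasurable (measurable_one.indicator hB).aemeasurable,
    lintegral_indicator hA, lintegral_indicator_one hB, ← Measure.restrict_pi_pi,
    ← Measure.restrict_pi_pi, Measure.restrict_restrict (hSM m), Measure.restrict_apply (hSM l)]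

end Splitting

section IidSumLaw

/-- The law of the sum of `m` independent variables with common law `ν`. -/
noncomputable def iidSumLaw (ν : Measure ℝ) (m : ℕ) : Measure ℝ :=
  (Measure.pi fun _ : Fin m => ν).map fun v => ∑ i, v i

instance (ν : Measure ℝ) [IsProbabilityMeasure ν] (m : ℕ) : IsProbabilityMeasure (iidSumLaw ν m) :=
  Measure.isProbabilityMeasure_map (by fun_prop)

variable {μ : Measure ℝ} [IsFiniteMeasure μ]

lemma iidSumLaw_cond (A : Set ℝ) (m : ℕ) :
    iidSumLaw (cond μ A) m = (μ A)⁻¹ ^ m • iidSumLaw (μ.restrict A) m := by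
  rw [iidSumLaw, iidSumLaw, ← Measure.map_smul]
  congr 1
  refine Measure.pi_eq fun s _ => ?_
  simp [ProbabilityTheory.cond, Measure.pi_pi, Finset.prod_mul_distrib]

lemma iidSumLaw_restrict (A : Set ℝ) (m : ℕ) :
    iidSumLaw (μ.restrict A) m
      = ((Measure.pi fun _ => μ).restrict (univ.pi fun _ : Fin m => A)).map fun v => ∑ i, v i := by
  rw [iidSumLaw, Measure.restrict_pi_pi]

lemma pow_smul_iidSumLaw_cond (A : Set ℝ) (m : ℕ) :
    μ A ^ m • iidSumLaw (cond μ A) m = iidSumLaw (μ.restrict A) m := by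
  rcases eq_or_ne (μ A) 0 with hA | hA
  · rcases m with _ | m
    · simp [iidSumLaw_cond]
    · have hbox : Measure.pi (fun _ : Fin (m + 1) => μ) (univ.pi fun _ => A) = 0 := by
        simp [Measure.pi_pi, hA]
      rw [iidSumLaw_restrict, Measure.restrict_eq_zero.2 hbox, Measure.map_zero, hA,
        zero_pow m.succ_ne_zero, zero_smul]
  · rw [iidSumLaw_cond, smul_smul, ← mul_pow, ENNReal.mul_inv_cancel hA (measure_ne_top μ A),
      one_pow, one_smul]

end IidSumLaw

section TruncSumKernel

variable (μ : Measure ℝ) [IsFiniteMeasure μ] (m : ℕ)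

/-- The kernel sending `y` to the law of the sum of `m` independent variables whose common law is
`μ` conditioned on `(-∞, y]`. -/
noncomputable def truncSumKernel : Kernel ℝ ℝ where
  toFun y := iidSumLaw (cond μ (Iic y)) m
  measurable' := by
    refine Measure.measurable_of_measurable_coe _ fun s hs => ?_
    have hsum : Measurable fun v : Fin m → ℝ => ∑ i, v i := by fun_prop
    simp only [iidSumLaw_cond, iidSumLaw_restrict, Measure.smul_apply, smul_eq_mul,
      Measure.map_apply hsum hs, Measure.restrict_apply (hsum hs)]
    have hcdf : Monotone fun y => μ (Iic y) := fun _ _ h => measure_mono (Iic_subset_Iic.2 h)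
    have hbox : Monotone fun y => Measure.pi (fun _ => μ)
        ((fun v : Fin m → ℝ => ∑ i, v i) ⁻¹' s ∩ univ.pi fun _ => Iic y) := fun _ _ h =>
      measure_mono (inter_subset_inter_right _ (pi_mono fun _ _ => Iic_subset_Iic.2 h))
    exact (hcdf.measurable.inv.pow_const m).mul hbox.measurable

lemma truncSumKernel_apply (y : ℝ) : truncSumKernel μ m y = iidSumLaw (cond μ (Iic y)) m := rfl

instance : IsFiniteKernel (truncSumKernel μ m) := by
  refine ⟨1, ENNReal.one_lt_top, fun y => ?_⟩
  rw [truncSumKernel_apply, iidSumLaw, Measure.map_apply (by fun_prop) .univ, preimage_univ,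
    Measure.pi_univ]
  refine Finset.prod_le_one' fun _ _ => ?_
  rw [ProbabilityTheory.cond, Measure.smul_apply, Measure.restrict_apply_univ]
  exact ENNReal.inv_mul_le_one _

end TruncSumKernel

section JointLaw

variable (μ : Measure ℝ) (m l : ℕ)

lemma measurable_sortVec_midIndex_sum_headVec :
    Measurable fun v : Fin (m + 1 + l) → ℝ =>
      (sortVec v (midIndex m l), ∑ i, headVec (sortVec v) i) := by
  have := measurable_sortVec (β := ℝ) (n := m + 1 + l)
  unfold headVec
  fun_prop

/-- The density, with respect to `μ`, of the `(m + 1)`-th smallest of `m + 1 + l` independent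
variables with common atomless law `μ`. -/
noncomputable def orderStatDensity (z : ℝ) : ENNReal :=
  (m + 1 + l).factorial / (m.factorial * l.factorial) * (μ (Iic z) ^ m * μ (Ioi z) ^ l)

lemma measurable_orderStatDensity : Measurable (orderStatDensity μ m l) := by
  have hIic : Monotone fun z => μ (Iic z) := fun _ _ h => measure_mono (Iic_subset_Iic.2 h)
  have hIoi : Antitone fun z => μ (Ioi z) := fun _ _ h => measure_mono (Ioi_subset_Ioi h)
  exact ((hIic.measurable.pow_const m).mul (hIoi.measurable.pow_const l)).const_mul _

variable [IsFiniteMeasure μ]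

lemma orderStatDensity_mul_truncSumKernel_univ (z : ℝ) :
    orderStatDensity μ m l z * truncSumKernel μ m z univ = orderStatDensity μ m l z := by
  have hmass : μ (Iic z) ^ m * truncSumKernel μ m z univ = μ (Iic z) ^ m := by
    rw [truncSumKernel_apply, ← smul_eq_mul, ← Measure.smul_apply, pow_smul_iidSumLaw_cond,
      iidSumLaw, Measure.map_apply (by fun_prop) .univ, preimage_univ, Measure.pi_univ]
    simp
  calc orderStatDensity μ m l z * truncSumKernel μ m z univ
      = (m + 1 + l).factorial / (m.factorial * l.factorial)
          * (μ (Iic z) ^ m * truncSumKernel μ m z univ * μ (Ioi z) ^ l) := by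
        rw [orderStatDensity]; ring
    _ = orderStatDensity μ m l z := by rw [hmass, orderStatDensity]

variable {μ} [NullSingletonClass μ]

lemma factorial_mul_setLIntegral_strictMono_Iio {g : ℝ → ENNReal} (hg : Measurable g) (z : ℝ) :
    m.factorial * ∫⁻ a in {a | StrictMono a}, g (∑ i, a i)
        ∂Measure.pi (fun _ : Fin m => μ.restrict (Iio z))
      = μ (Iic z) ^ m * ∫⁻ s, g s ∂truncSumKernel μ m z := by
  rw [truncSumKernel_apply, ← smul_eq_mul (μ (Iic z) ^ m), ← lintegral_smul_measure,
    pow_smul_iidSumLaw_cond, iidSumLaw, lintegral_map hg (by fun_prop),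
    ← restrict_Iio_eq_restrict_Iic, factorial_mul_setLIntegral_strictMono_sum _ hg]

lemma lintegral_sortVec_midIndex_sum_headVec {g : ℝ × ℝ → ENNReal} (hg : Measurable g) :
    ∫⁻ v, g (sortVec v (midIndex m l), ∑ i, headVec (sortVec v) i)
        ∂Measure.pi (fun _ : Fin (m + 1 + l) => μ)
      = ∫⁻ z, orderStatDensity μ m l z * ∫⁻ s, g (z, s) ∂truncSumKernel μ m z ∂μ := by
  have hF : Measurable fun v : Fin (m + 1 + l) → ℝ => g (v (midIndex m l), ∑ i, headVec v i) := by
    unfold headVec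
    fun_prop
  have hF' : Measurable (Function.uncurry fun (z : ℝ) (a : Fin m → ℝ) => g (z, ∑ i, a i)) := by
    unfold Function.uncurry
    fun_prop
  rw [lintegral_comp_sortVec μ hF, setLIntegral_strictMono_eq_lintegral_mul μ hF',
    ← lintegral_const_mul' _ _ (ENNReal.natCast_ne_top _)]
  refine lintegral_congr fun z => ?_
  set I := ∫⁻ a in {a | StrictMono a}, g (z, ∑ i, a i)
    ∂Measure.pi fun _ : Fin m => μ.restrict (Iio z)
  set J := Measure.pi (fun _ : Fin l => μ.restrict (Ioi z)) {b | StrictMono b}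
  have hI : m.factorial * I = μ (Iic z) ^ m * ∫⁻ s, g (z, s) ∂truncSumKernel μ m z :=
    factorial_mul_setLIntegral_strictMono_Iio m (g := fun s => g (z, s)) (by fun_prop) z
  have hJ : l.factorial * J = μ (Ioi z) ^ l := by
    rw [factorial_mul_pi_strictMono, Measure.restrict_apply_univ]
  have hcancel : ((m + 1 + l).factorial : ENNReal)
      = (m + 1 + l).factorial / (m.factorial * l.factorial) * (m.factorial * l.factorial) :=
    (ENNReal.div_mul_cancel (by exact_mod_cast mul_ne_zero m.factorial_ne_zero l.factorial_ne_zero)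
      (by exact_mod_cast ENNReal.natCast_ne_top (m.factorial * l.factorial))).symm
  calc (m + 1 + l).factorial * (I * J)
      = (m + 1 + l).factorial / (m.factorial * l.factorial)
          * ((m.factorial * I) * (l.factorial * J)) := by
        nth_rw 1 [hcancel]; ring
    _ = orderStatDensity μ m l z * ∫⁻ s, g (z, s) ∂truncSumKernel μ m z := by
        rw [hI, hJ, orderStatDensity]; ring

lemma map_sortVec_midIndex_sum_headVec :
    (Measure.pi fun _ : Fin (m + 1 + l) => μ).map
        (fun v => (sortVec v (midIndex m l), ∑ i, headVec (sortVec v) i))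
      = μ.withDensity (orderStatDensity μ m l) ⊗ₘ truncSumKernel μ m := by
  refine Measure.ext_of_lintegral _ fun g hg => ?_
  rw [lintegral_map hg (measurable_sortVec_midIndex_sum_headVec m l), Measure.lintegral_compProd hg,
    lintegral_withDensity_eq_lintegral_mul _ (measurable_orderStatDensity μ m l)
      hg.lintegral_kernel_prod_right', lintegral_sortVec_midIndex_sum_headVec m l hg]
  rfl

end JointLaw

section Averages

lemma tendsto_integral_cond_closedBall {E : Type*} [PseudoMetricSpace E] [MeasurableSpace E]
    [OpensMeasurableSpace E] {ρ : Measure E} [IsFiniteMeasure ρ] {φ : E → ℝ} {y : E}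
    (hy : y ∈ ρ.support) (hφ : AEStronglyMeasurable φ ρ) (hcont : ContinuousAt φ y) :
    Tendsto (fun ε => ∫ z, φ z ∂cond ρ (Metric.closedBall y ε)) (𝓝[>] 0) (𝓝 (φ y)) := by
  have hball : Tendsto (Metric.closedBall y) (𝓝[>] (0 : ℝ)) (𝓝 y).smallSets :=
    (tendsto_closedBall_smallSets y).mono_left nhdsWithin_le_nhds
  have hlittleO := hcont.integral_sub_linear_isLittleO_ae (μ := ρ)
    ⟨univ, univ_mem, by simpa using hφ⟩ hball
  have hlim := hlittleO.tendsto_div_nhds_zero.add_const (φ y)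
  rw [zero_add] at hlim
  refine hlim.congr' ?_
  filter_upwards [self_mem_nhdsWithin] with ε hε
  have hne : ρ.real (Metric.closedBall y ε) ≠ 0 := by
    rw [measureReal_ne_zero_iff]
    exact ((Measure.mem_support_iff_forall _).1 hy _ (Metric.closedBall_mem_nhds y hε)).ne'
  rw [ProbabilityTheory.cond, integral_smul_measure, ENNReal.toReal_inv, ← measureReal_def]
  simp only [smul_eq_mul]
  field_simp
  ring

lemma integral_comp_cond_preimage_of_map_eq_compProd {Ω E F : Type*} [MeasurableSpace Ω]
    [MeasurableSpace E] [MeasurableSpace F] {P : Measure Ω} [IsFiniteMeasure P] {Z : Ω → E}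
    {T : Ω → F} (hZ : Measurable Z) (hT : Measurable T) {κ : Kernel E F} [IsFiniteKernel κ]
    (h : P.map (fun ω => (Z ω, T ω)) = P.map Z ⊗ₘ κ) {f : F → ℝ} (hf : StronglyMeasurable f)
    (hint : Integrable (fun ω => f (T ω)) P) {A : Set E} (hA : MeasurableSet A) :
    ∫ ω, f (T ω) ∂cond P (Z ⁻¹' A) = ∫ z, ∫ t, f t ∂κ z ∂cond (P.map Z) A := by
  have hZT := (hZ.prodMk hT).aemeasurable (μ := P)
  have hf₂ : StronglyMeasurable fun q : E × F => f q.2 := hf.comp_measurable measurable_snd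
  have hint₂ : Integrable (fun q : E × F => f q.2) (P.map Z ⊗ₘ κ) := by
    rw [← h]
    exact (integrable_map_measure hf₂.aestronglyMeasurable hZT).2 hint
  have hset : ∫ ω in Z ⁻¹' A, f (T ω) ∂P = ∫ z in A, ∫ t, f t ∂κ z ∂P.map Z := by
    have hprod := Measure.setIntegral_compProd hA .univ hint₂.integrableOn
    rw [← h, setIntegral_map (hA.prod .univ) hf₂.aestronglyMeasurable hZT,
      mk_preimage_prod] at hprod
    simpa using hprod
  rw [ProbabilityTheory.cond, ProbabilityTheory.cond, integral_smul_measure, integral_smul_measure,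
    hset, Measure.map_apply hZ hA]

lemma IsCondLawAt.unique {Ω : Type*} [MeasurableSpace Ω] {P : Measure Ω} {T Z : Ω → ℝ} {y : ℝ}
    {ν ν' : Measure ℝ} (h : IsCondLawAt P T Z y ν) (h' : IsCondLawAt P T Z y ν') : ν = ν' := by
  have := h.1
  have := h'.1
  exact ext_of_forall_integral_eq_of_IsFiniteMeasure fun f =>
    tendsto_nhds_unique (h.2.2 f) (h'.2.2 f)

lemma isCondLawAt_of_map_eq_compProd {Ω : Type*} [MeasurableSpace Ω] {P : Measure Ω}
    [IsFiniteMeasure P] {T Z : Ω → ℝ} (hZ : Measurable Z) (hT : Measurable T) {κ : Kernel ℝ ℝ}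
    [IsFiniteKernel κ] (h : P.map (fun ω => (Z ω, T ω)) = P.map Z ⊗ₘ κ) {y : ℝ}
    (hy : y ∈ (P.map Z).support) (hprob : IsProbabilityMeasure (κ y))
    (hcont : ∀ f : ℝ →ᵇ ℝ, ContinuousAt (fun z => ∫ t, f t ∂κ z) y) :
    IsCondLawAt P T Z y (κ y) := by
  refine ⟨hprob, fun ε hε => ?_, fun f => ?_⟩
  · rw [← Measure.map_apply hZ measurableSet_Icc]
    exact ((Measure.mem_support_iff_forall _).1 hy _
      (Icc_mem_nhds (sub_lt_self y hε) (lt_add_of_pos_right y hε))).ne'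
  · have hf := f.continuous.stronglyMeasurable
    have hint : Integrable (fun ω => f (T ω)) P :=
      .of_bound (hf.comp_measurable hT).aestronglyMeasurable ‖f‖
        (ae_of_all _ fun ω => f.norm_coe_le_norm _)
    refine (tendsto_integral_cond_closedBall hy
      hf.integral_kernel.aestronglyMeasurable (hcont f)).congr fun ε => ?_
    rw [Real.closedBall_eq_Icc]
    exact (integral_comp_cond_preimage_of_map_eq_compProd hZ hT h hf hint measurableSet_Icc).symm

end Averages

section OrderStatistics

variable {Ω : Type*} (X : ℕ → Ω → ℝ) (m l : ℕ)

lemma orderStat_eq_sortVec (n : ℕ) (i : Fin n) (ω : Ω) :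
    orderStat X n (i + 1) ω = sortVec (fun j : Fin n => X j ω) i := by
  simp [orderStat, sortVec]

lemma orderStat_eq_sortVec_midIndex (ω : Ω) :
    orderStat X (m + 1 + l) (m + 1) ω
      = sortVec (fun j : Fin (m + 1 + l) => X j ω) (midIndex m l) :=
  orderStat_eq_sortVec X (m + 1 + l) (midIndex m l) ω

lemma trimmedSum_eq_sum_headVec (ω : Ω) :
    trimmedSum X (m + 1 + l) (l + 1) ω
      = ∑ i, headVec (sortVec fun j : Fin (m + 1 + l) => X j ω) i := by
  have hm : m + 1 + l - (l + 1) = m := by omega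
  have hIcc : Finset.Icc 1 m = Finset.Ico (0 + 1) (m + 1) := rfl
  rw [trimmedSum, hm, hIcc, ← Finset.sum_Ico_add', ← Finset.range_eq_Ico,
    ← Fin.sum_univ_eq_sum_range]
  exact Finset.sum_congr rfl fun i _ =>
    orderStat_eq_sortVec X (m + 1 + l) (Fin.castAdd l (Fin.castAdd 1 i)) ω

variable {X} [MeasurableSpace Ω]

lemma measurable_orderStat (hX : ∀ i, Measurable (X i)) (n j : ℕ) :
    Measurable (orderStat X n j) := by
  by_cases h : 1 ≤ j ∧ j ≤ n
  · have hvec : Measurable fun ω => sortVec fun i : Fin n => X i ω :=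
      measurable_sortVec.comp (measurable_pi_lambda _ fun i => hX i)
    convert (measurable_pi_apply (⟨j - 1, by omega⟩ : Fin n)).comp hvec using 1
    ext ω
    simp [orderStat, sortVec, h]
  · convert measurable_const (a := (0 : ℝ)) using 1
    ext ω
    exact dif_neg h

lemma measurable_trimmedSum (hX : ∀ i, Measurable (X i)) (n k : ℕ) :
    Measurable (trimmedSum X n k) :=
  Finset.measurable_fun_sum _ fun j _ => measurable_orderStat hX n j

variable {P : Measure Ω} [IsProbabilityMeasure P] {μ : Measure ℝ} [IsProbabilityMeasure μ]
  [NullSingletonClass μ]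

lemma map_orderStat_trimmedSum (hX : ∀ i, Measurable (X i)) (hindep : iIndepFun X P)
    (hlaw : ∀ i, P.map (X i) = μ) {n k : ℕ} (hk : 1 ≤ k) (hkn : k ≤ n) :
    P.map (fun ω => (orderStat X n (n - k + 1) ω, trimmedSum X n k ω))
      = μ.withDensity (orderStatDensity μ (n - k) (k - 1)) ⊗ₘ truncSumKernel μ (n - k) := by
  obtain ⟨l, rfl⟩ := Nat.exists_eq_add_of_le' hk
  obtain ⟨m, rfl⟩ := Nat.exists_eq_add_of_le hkn
  have hm : l + 1 + m - (l + 1) = m := by omega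
  have hn : l + 1 + m = m + 1 + l := by omega
  have hvec : P.map (fun ω (i : Fin (m + 1 + l)) => X i ω) = Measure.pi fun _ => μ := by
    have hpi := (iIndepFun_iff_map_fun_eq_pi_map fun i : Fin (m + 1 + l) =>
      (hX i).aemeasurable).1 (hindep.precomp (g := Fin.val) Fin.val_injective)
    simpa only [hlaw] using hpi
  rw [hm, hn, Nat.add_sub_cancel]
  simp only [orderStat_eq_sortVec_midIndex, trimmedSum_eq_sum_headVec]
  rw [← map_sortVec_midIndex_sum_headVec, ← hvec,
    Measure.map_map (measurable_sortVec_midIndex_sum_headVec m l)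
      (measurable_pi_lambda _ fun i => hX i)]
  rfl

lemma map_orderStat (hX : ∀ i, Measurable (X i)) (hindep : iIndepFun X P)
    (hlaw : ∀ i, P.map (X i) = μ) {n k : ℕ} (hk : 1 ≤ k) (hkn : k ≤ n) :
    P.map (orderStat X n (n - k + 1)) = μ.withDensity (orderStatDensity μ (n - k) (k - 1)) := by
  have hjoint := congrArg Measure.fst (map_orderStat_trimmedSum hX hindep hlaw hk hkn)
  rw [Measure.fst_map_prodMk (measurable_trimmedSum hX _ _)] at hjoint
  ext s hs
  rw [hjoint, Measure.fst_apply hs, ← prod_univ, Measure.compProd_apply_prod hs .univ,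
    setLIntegral_withDensity_eq_setLIntegral_mul _ (measurable_orderStatDensity μ _ _)
      (Kernel.measurable_coe _ .univ) hs, withDensity_apply _ hs]
  exact lintegral_congr fun z => orderStatDensity_mul_truncSumKernel_univ μ _ _ z

lemma map_orderStat_trimmedSum_eq_compProd (hX : ∀ i, Measurable (X i)) (hindep : iIndepFun X P)
    (hlaw : ∀ i, P.map (X i) = μ) {n k : ℕ} (hk : 1 ≤ k) (hkn : k ≤ n) :
    P.map (fun ω => (orderStat X n (n - k + 1) ω, trimmedSum X n k ω))
      = P.map (orderStat X n (n - k + 1)) ⊗ₘ truncSumKernel μ (n - k) := by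
  rw [map_orderStat_trimmedSum hX hindep hlaw hk hkn, map_orderStat hX hindep hlaw hk hkn]

lemma condDistrib_trimmedSum_ae_eq (hX : ∀ i, Measurable (X i)) (hindep : iIndepFun X P)
    (hlaw : ∀ i, P.map (X i) = μ) {n k : ℕ} (hk : 1 ≤ k) (hkn : k ≤ n) :
    ∀ᵐ y ∂P.map (orderStat X n (n - k + 1)),
      condDistrib (trimmedSum X n k) (orderStat X n (n - k + 1)) P y
        = iidSumLaw (cond μ (Iic y)) (n - k) :=
  condDistrib_ae_eq_of_measure_eq_compProd _ (measurable_trimmedSum hX n k).aemeasurable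
    (map_orderStat_trimmedSum_eq_compProd hX hindep hlaw hk hkn)

end OrderStatistics

section WeakLimit

lemma continuousAt_setIntegral_of_eventually_mem_iff {E β : Type*} [TopologicalSpace E]
    [FirstCountableTopology E] [MeasurableSpace β] {ρ : Measure β} {B : E → Set β}
    (hB : ∀ z, MeasurableSet (B z)) {F : β → ℝ} (hF : Integrable F ρ) {y : E}
    (hmem : ∀ᵐ v ∂ρ, ∀ᶠ z in 𝓝 y, (v ∈ B z ↔ v ∈ B y)) :
    ContinuousAt (fun z => ∫ v in B z, F v ∂ρ) y := by
  simp only [← integral_indicator (hB _)]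
  refine continuousAt_of_dominated (.of_forall fun z => (hF.indicator (hB z)).aestronglyMeasurable)
    (.of_forall fun z => ae_of_all _ fun v => norm_indicator_le_norm_self F v) hF.norm ?_
  filter_upwards [hmem] with v hv
  refine (continuousAt_const (y := (B y).indicator F v)).congr ?_
  filter_upwards [hv] with z hz
  by_cases hy : v ∈ B y <;> simp [hz, hy]

lemma eventually_le_iff_le_of_ne {β : Type*} [LinearOrder β] [TopologicalSpace β] [OrderTopology β]
    {x y : β} (h : x ≠ y) : ∀ᶠ z in 𝓝 y, (x ≤ z ↔ x ≤ y) := by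
  rcases h.lt_or_gt with hxy | hyx
  · filter_upwards [lt_mem_nhds hxy] with z hz using iff_of_true hz.le hxy.le
  · filter_upwards [gt_mem_nhds hyx] with z hz using iff_of_false hz.not_ge hyx.not_ge

variable (μ : Measure ℝ) [IsFiniteMeasure μ] [NullSingletonClass μ]

lemma continuous_measureReal_Iic : Continuous fun z => μ.real (Iic z) := by
  refine continuous_iff_continuousAt.2 fun y => ?_
  simpa using continuousAt_setIntegral_of_eventually_mem_iff
    (fun z : ℝ => measurableSet_Iic (a := z)) (integrable_const (μ := μ) (1 : ℝ))
    ((Measure.ae_ne μ y).mono fun x hx => eventually_le_iff_le_of_ne hx)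

variable {μ}

lemma continuousAt_integral_truncSumKernel (m : ℕ) (f : ℝ →ᵇ ℝ) {y : ℝ} (hy : μ (Iic y) ≠ 0) :
    ContinuousAt (fun z => ∫ t, f t ∂truncSumKernel μ m z) y := by
  have hf : Continuous fun v : Fin m → ℝ => f (∑ i, v i) := by fun_prop
  have hintegral (z : ℝ) : ∫ t, f t ∂truncSumKernel μ m z
      = (μ.real (Iic z))⁻¹ ^ m
        * ∫ v in univ.pi fun _ : Fin m => Iic z, f (∑ i, v i) ∂Measure.pi fun _ => μ := by
    rw [truncSumKernel_apply, iidSumLaw_cond, iidSumLaw_restrict, integral_smul_measure,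
      integral_map (by fun_prop) f.continuous.aestronglyMeasurable, ENNReal.toReal_pow,
      ENNReal.toReal_inv, ← measureReal_def, smul_eq_mul]
  have hint : Integrable (fun v : Fin m → ℝ => f (∑ i, v i)) (Measure.pi fun _ => μ) :=
    .of_bound hf.aestronglyMeasurable ‖f‖ (ae_of_all _ fun v => f.norm_coe_le_norm _)
  have hbox : ∀ᵐ v ∂Measure.pi fun _ : Fin m => μ, ∀ᶠ z in 𝓝 y,
      (v ∈ univ.pi (fun _ => Iic z) ↔ v ∈ univ.pi fun _ => Iic y) := by
    filter_upwards [ae_all_iff.2 fun i => Measure.ae_eval_ne (fun _ : Fin m => μ) i y] with v hv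
    filter_upwards [eventually_all.2 fun i => eventually_le_iff_le_of_ne (hv i)] with z hz
    simp only [mem_univ_pi, mem_Iic, hz]
  simp only [hintegral]
  exact (((continuous_measureReal_Iic μ).continuousAt.inv₀
    ((measureReal_ne_zero_iff (measure_ne_top μ _)).2 hy)).pow m).mul
    (continuousAt_setIntegral_of_eventually_mem_iff
      (fun z => .univ_pi fun _ => measurableSet_Iic) hint hbox)

lemma mem_support_withDensity_orderStatDensity (m l : ℕ) {y : ℝ} (hy : y ∈ μ.support)
    (hIic : μ (Iic y) ≠ 0) (hIoi : μ (Ioi y) ≠ 0) :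
    y ∈ (μ.withDensity (orderStatDensity μ m l)).support := by
  have hpos : ∀ᶠ z in 𝓝 y, orderStatDensity μ m l z ≠ 0 := by
    have hcont := continuous_measureReal_Iic μ
    have hreal (z : ℝ) : μ.real (Ioi z) = μ.real univ - μ.real (Iic z) := by
      rw [← compl_Iic, measureReal_compl measurableSet_Iic]
    have hcont' : Continuous fun z => μ.real (Ioi z) := by
      simp only [hreal]
      exact continuous_const.sub hcont
    filter_upwards [
      hcont.continuousAt.eventually_ne ((measureReal_ne_zero_iff (by finiteness)).2 hIic),
      hcont'.continuousAt.eventually_ne ((measureReal_ne_zero_iff (by finiteness)).2 hIoi)]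
      with z h₁ h₂
    rw [measureReal_ne_zero_iff] at h₁ h₂
    refine mul_ne_zero (ENNReal.div_ne_zero.2 ⟨?_, ?_⟩)
      (mul_ne_zero (pow_ne_zero m h₁) (pow_ne_zero l h₂))
    · exact_mod_cast (m + 1 + l).factorial_ne_zero
    · exact_mod_cast ENNReal.natCast_ne_top (m.factorial * l.factorial)
  refine (Measure.mem_support_iff_forall _).2 fun U hU => pos_iff_ne_zero.2 fun h => ?_
  rw [withDensity_apply_eq_zero (measurable_orderStatDensity μ m l)] at h
  exact ((Measure.mem_support_iff_forall _).1 hy _ (inter_mem hpos hU)).ne' h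

lemma isCondLawAt_trimmedSum_iff {Ω : Type*} [MeasurableSpace Ω] {P : Measure Ω}
    [IsProbabilityMeasure P] [IsProbabilityMeasure μ] {X : ℕ → Ω → ℝ} (hX : ∀ i, Measurable (X i))
    (hindep : iIndepFun X P) (hlaw : ∀ i, P.map (X i) = μ) {n k : ℕ} (hk : 1 ≤ k) (hkn : k ≤ n)
    {y : ℝ} (hy : y ∈ μ.support) (hIic : μ (Iic y) ≠ 0) (hIoi : μ (Ioi y) ≠ 0) {ν : Measure ℝ} :
    IsCondLawAt P (trimmedSum X n k) (orderStat X n (n - k + 1)) y ν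
      ↔ ν = iidSumLaw (cond μ (Iic y)) (n - k) := by
  have hsupp : y ∈ (P.map (orderStat X n (n - k + 1))).support := by
    rw [map_orderStat hX hindep hlaw hk hkn]
    exact mem_support_withDensity_orderStatDensity _ _ hy hIic hIoi
  have hprob := cond_isProbabilityMeasure hIic
  have hcond : IsCondLawAt P (trimmedSum X n k) (orderStat X n (n - k + 1)) y
      (iidSumLaw (cond μ (Iic y)) (n - k)) :=
    isCondLawAt_of_map_eq_compProd (measurable_orderStat hX _ _) (measurable_trimmedSum hX _ _)
      (map_orderStat_trimmedSum_eq_compProd hX hindep hlaw hk hkn) hsupp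
      (inferInstanceAs (IsProbabilityMeasure (iidSumLaw _ _)))
      fun f => continuousAt_integral_truncSumKernel _ f hIic
  exact ⟨fun h => h.unique hcond, fun h => h ▸ hcond⟩

end WeakLimit

section Moments

variable {ν : Measure ℝ} [IsProbabilityMeasure ν]

lemma memLp_iidSumLaw {p : ENNReal} (h : MemLp (fun t => t) p ν) (m : ℕ) :
    MemLp (fun t => t) p (iidSumLaw ν m) := by
  rw [iidSumLaw, memLp_map_measure_iff (g := fun t : ℝ => t) aestronglyMeasurable_id (by fun_prop)]
  exact memLp_finsetSum _ fun i _ =>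
    h.comp_measurePreserving (measurePreserving_eval (fun _ : Fin m => ν) i)

lemma integral_iidSumLaw (h : Integrable (fun t => t) ν) (m : ℕ) :
    ∫ t, t ∂iidSumLaw ν m = m * ∫ t, t ∂ν := by
  rw [iidSumLaw, integral_map (f := fun t : ℝ => t) (by fun_prop) aestronglyMeasurable_id,
    integral_finsetSum _ fun i _ => integrable_comp_eval (μ := fun _ : Fin m => ν) (i := i) h]
  simp [integral_comp_eval (μ := fun _ : Fin m => ν) (f := fun t : ℝ => t) aestronglyMeasurable_id]

lemma variance_iidSumLaw (h : MemLp (fun t => t) 2 ν) (m : ℕ) :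
    variance (fun t => t) (iidSumLaw ν m) = m * variance (fun t => t) ν := by
  have hsum := variance_sum_pi (μ := fun _ : Fin m => ν) (X := fun _ t => t) fun _ => h
  rw [Finset.sum_const, Finset.card_univ, Fintype.card_fin, nsmul_eq_mul] at hsum
  rw [iidSumLaw, variance_map (X := fun t : ℝ => t) aemeasurable_id (by fun_prop), ← hsum]
  congr 1
  ext v
  simp

lemma variance_pos_of_nullSingletonClass [NullSingletonClass ν] (h : MemLp (fun t => t) 2 ν) :
    0 < variance (fun t => t) ν := by
  refine (variance_nonneg _ _).lt_of_ne fun hzero => ?_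
  obtain ⟨x, hx, hne⟩ := ((ae_eq_integral_of_variance_eq_zero h hzero.symm).and
    (Measure.ae_ne ν (∫ t, t ∂ν))).exists
  exact hne hx

end Moments

section CentralLimitTheorem

lemma map_sum_range_infinitePi (ν : Measure ℝ) [IsProbabilityMeasure ν] (m : ℕ) :
    (Measure.infinitePi fun _ : ℕ => ν).map (fun ω => ∑ i ∈ Finset.range m, ω i)
      = iidSumLaw ν m := by
  have hindep : iIndepFun (fun (i : ℕ) (ω : ℕ → ℝ) => ω i) (Measure.infinitePi fun _ => ν) :=
    iIndepFun_infinitePi (X := fun _ x => x) fun _ => measurable_id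
  have hpi := (iIndepFun_iff_map_fun_eq_pi_map fun i : Fin m =>
    (measurable_pi_apply (i : ℕ)).aemeasurable).1 (hindep.precomp (g := Fin.val) Fin.val_injective)
  simp only [Measure.infinitePi_map_eval] at hpi
  rw [iidSumLaw, ← hpi, Measure.map_map (by fun_prop) (by fun_prop)]
  congr 1
  ext ω
  exact (Fin.sum_univ_eq_sum_range ω m).symm

lemma gaussianReal_real_Iic {a V : ℝ} (hV : 0 < V) (x : ℝ) :
    (gaussianReal a V.toNNReal).real (Iic x) = (gaussianReal 0 1).real (Iic ((x - a) / √V)) := by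
  have hmap : (gaussianReal 0 1).map (fun t => √V * t + a) = gaussianReal a V.toNNReal := by
    have hcomp : (fun t => √V * t + a) = (· + a) ∘ (√V * ·) := rfl
    rw [hcomp, ← Measure.map_map (by fun_prop) (by fun_prop), gaussianReal_map_const_mul,
      gaussianReal_map_add_const]
    congr 1
    · simp
    · ext
      simp [Real.sq_sqrt hV.le, hV.le]
  have hpre : (fun t => √V * t + a) ⁻¹' Iic x = Iic ((x - a) / √V) := by
    ext t
    rw [mem_preimage, mem_Iic, mem_Iic, le_div_iff₀' (Real.sqrt_pos.2 hV), le_sub_iff_add_le]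
  rw [← hmap, map_measureReal_apply (by fun_prop) measurableSet_Iic, hpre]

variable {ν : Measure ℝ} [IsProbabilityMeasure ν]

lemma tendsto_iidSumLaw_real_setOf_inv_sqrt_mul_le (hV : 0 < variance (fun t => t) ν) (x : ℝ) :
    Tendsto (fun m : ℕ => (iidSumLaw ν m).real {t | (√m)⁻¹ * (t - m * ∫ s, s ∂ν) ≤ x})
      atTop (𝓝 ((gaussianReal 0 (variance (fun t => t) ν).toNNReal).real (Iic x))) := by
  set Q := Measure.infinitePi fun _ : ℕ => ν
  set V := variance (fun t => t) ν
  have heval (i : ℕ) : MeasurePreserving (fun ω : ℕ → ℝ => ω i) Q ν :=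
    measurePreserving_eval_infinitePi _ i
  have hlaw : HasLaw (fun ω : ℕ → ℝ => ω 0) ν Q := (heval 0).hasLaw
  have hL := memLp_two_of_variance_ne_zero aestronglyMeasurable_id hV.ne'
  have hident (i : ℕ) : IdentDistrib (fun ω : ℕ → ℝ => ω i) (fun ω => ω 0) Q Q :=
    (heval i).hasLaw.identDistrib (heval 0).hasLaw
  have hclt := tendstoInDistribution_inv_sqrt_mul_sum_sub (P' := gaussianReal 0 V.toNNReal)
    (Y := id) (X := fun i (ω : ℕ → ℝ) => ω i) (P := Q)
    ⟨aemeasurable_id, by rw [Measure.map_id, hlaw.variance_eq]; rfl⟩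
    (hL.comp_measurePreserving (heval 0))
    (iIndepFun_infinitePi (X := fun _ x => x) fun _ => measurable_id) hident
  have := nullSingletonClass_gaussianReal (μ := 0) (Real.toNNReal_pos.2 hV).ne'
  have hlim := ProbabilityMeasure.tendsto_measure_of_null_frontier_of_tendsto' hclt.tendsto
    (E := Iic x) (by simp)
  simp only [ProbabilityMeasure.coe_mk, Measure.map_id] at hlim
  refine ((ENNReal.tendsto_toReal (measure_ne_top _ _)).comp hlim).congr fun m => ?_
  rw [← map_sum_range_infinitePi, map_measureReal_apply (by fun_prop)
    (measurableSet_le (by fun_prop) measurable_const), Function.comp_apply, hlaw.integral_eq,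
    Measure.map_apply (by fun_prop) measurableSet_Iic]
  rfl

lemma tendsto_iidSumLaw_real_setOf_standardized_le (hV : 0 < variance (fun t => t) ν) (x : ℝ) :
    Tendsto (fun m : ℕ => (iidSumLaw ν m).real
        {t | (t - m * ∫ s, s ∂ν) / √(m * variance (fun t => t) ν) ≤ x})
      atTop (𝓝 ((gaussianReal 0 1).real (Iic x))) := by
  have hσ := Real.sqrt_pos.2 hV
  convert tendsto_iidSumLaw_real_setOf_inv_sqrt_mul_le hV (x * √(variance (fun t => t) ν))
    using 2 with m
  · congr 1
    ext t
    rw [mem_ofPred_eq, mem_ofPred_eq, ← div_le_iff₀ hσ, Real.sqrt_mul m.cast_nonneg, ← div_div,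
      inv_mul_eq_div]
  · rw [gaussianReal_real_Iic hV, sub_zero, mul_div_cancel_right₀ _ hσ.ne']

end CentralLimitTheorem

section Polya

variable {ι α : Type*} [LinearOrder α] [TopologicalSpace α] [OrderTopology α] {F : ι → α → ℝ}
  {G : α → ℝ} {p : Filter ι}

lemma tendstoLocallyUniformly_of_monotone (hF : ∀ i, Monotone (F i)) (hcont : Continuous G)
    (h : ∀ x, Tendsto (fun i => F i x) p (𝓝 (G x))) : TendstoLocallyUniformly F G p := by
  refine Metric.tendstoLocallyUniformly_iff.2 fun ε hε x => ?_
  obtain ⟨a, b, -, hab, hsub⟩ := exists_Icc_mem_subset_of_mem_nhds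
    (hcont.continuousAt (Metric.ball_mem_nhds (G x) (show 0 < ε / 4 by positivity)))
  refine ⟨Icc a b, hab, ?_⟩
  filter_upwards [(h a).eventually (Metric.ball_mem_nhds _ (show 0 < ε / 2 by positivity)),
    (h b).eventually (Metric.ball_mem_nhds _ (show 0 < ε / 2 by positivity))] with i ha hb z hz
  have hab' : a ≤ b := hz.1.trans hz.2
  have hGa := hsub (left_mem_Icc.2 hab')
  have hGb := hsub (right_mem_Icc.2 hab')
  have hGz := hsub hz
  have hFa := hF i hz.1
  have hFb := hF i hz.2
  simp only [mem_preimage, Metric.mem_ball, Real.dist_eq, abs_lt] at ha hb hGa hGb hGz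
  rw [Real.dist_eq, abs_lt]
  constructor <;> linarith

lemma tendstoUniformly_of_monotone [CompactIccSpace α] [Nonempty α] (hF : ∀ i, Monotone (F i))
    (hF₀ : ∀ i x, 0 ≤ F i x) (hF₁ : ∀ i x, F i x ≤ 1) (hG : Monotone G) (hcont : Continuous G)
    (hbot : Tendsto G atBot (𝓝 0)) (htop : Tendsto G atTop (𝓝 1))
    (h : ∀ x, Tendsto (fun i => F i x) p (𝓝 (G x))) : TendstoUniformly F G p := by
  refine Metric.tendstoUniformly_iff.2 fun ε hε => ?_
  obtain ⟨a, ha⟩ := (hbot.eventually_lt_const hε).exists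
  obtain ⟨b, hb⟩ := (htop.eventually_const_lt (sub_lt_self 1 hε)).exists
  have hmid := (tendstoLocallyUniformlyOn_iff_tendstoUniformlyOn_of_compact isCompact_Icc).1
    ((tendstoLocallyUniformly_of_monotone hF hcont h).tendstoLocallyUniformlyOn (s := Icc a b))
  filter_upwards [Metric.tendstoUniformlyOn_iff.1 hmid ε hε, (h a).eventually_lt_const ha,
    (h b).eventually_const_lt hb] with i hi hFa hFb x
  have hG₀ : 0 ≤ G x := hG.le_of_tendsto hbot x
  have hG₁ : G x ≤ 1 := hG.ge_of_tendsto htop x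
  have hFx₀ := hF₀ i x
  have hFx₁ := hF₁ i x
  rw [Real.dist_eq, abs_lt]
  rcases le_total x a with hxa | hax
  · have hFx := hF i hxa
    have hGx := hG hxa
    constructor <;> linarith
  rcases le_total b x with hbx | hxb
  · have hFx := hF i hbx
    have hGx := hG hbx
    constructor <;> linarith
  · exact abs_lt.1 (hi x ⟨hax, hxb⟩)

lemma eventually_forall_abs_iidSumLaw_real_Iic_sub_lt {ν : Measure ℝ} [IsProbabilityMeasure ν]
    (hV : 0 < variance (fun t => t) ν) {ε : ℝ} (hε : 0 < ε) : ∀ᶠ m : ℕ in atTop, ∀ x : ℝ,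
      |(iidSumLaw ν m).real (Iic x)
        - (gaussianReal (m * ∫ t, t ∂ν) (m * variance (fun t => t) ν).toNNReal).real (Iic x)|
        < ε := by
  set a := ∫ t, t ∂ν
  set V := variance (fun t => t) ν
  have := nullSingletonClass_gaussianReal (μ := 0) one_ne_zero
  have hunif : TendstoUniformly
      (fun m x => (iidSumLaw ν m).real {t | (t - m * a) / √(m * V) ≤ x})
      (cdf (gaussianReal 0 1)) atTop := by
    refine tendstoUniformly_of_monotone
      (fun m x x' hx => measureReal_mono fun t (ht : _ ≤ x) => ht.trans hx)
      (fun _ _ => measureReal_nonneg) (fun _ _ => measureReal_le_one) (monotone_cdf _) ?_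
      (tendsto_cdf_atBot _) (tendsto_cdf_atTop _) fun x => ?_
    · exact (continuous_measureReal_Iic _).congr fun x => (cdf_eq_real _ x).symm
    · rw [cdf_eq_real]
      exact tendsto_iidSumLaw_real_setOf_standardized_le hV x
  filter_upwards [Metric.tendstoUniformly_iff.1 hunif ε hε, eventually_gt_atTop 0] with m hm hm0 x
  have hmV : 0 < m * V := mul_pos (Nat.cast_pos.2 hm0) hV
  have hset : {t : ℝ | (t - m * a) / √(m * V) ≤ (x - m * a) / √(m * V)} = Iic x := by
    ext t
    rw [mem_ofPred_eq, div_le_div_iff_of_pos_right (Real.sqrt_pos.2 hmV), sub_le_sub_iff_right,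
      mem_Iic]
  have hx := hm ((x - m * a) / √(m * V))
  rwa [cdf_eq_real, ← gaussianReal_real_Iic hmV, hset, dist_comm, Real.dist_eq] at hx

end Polya

section Pareto

instance (t r : ℝ) : NullSingletonClass (paretoMeasure t r) := by
  unfold paretoMeasure
  infer_instance

lemma ae_le_paretoMeasure (t r : ℝ) : ∀ᵐ x ∂paretoMeasure t r, t ≤ x := by
  simp only [ae_iff, not_le]
  exact (withDensity_apply _ measurableSet_Iio).trans (lintegral_paretoPDF_of_le le_rfl)

lemma paretoMeasure_Ioo_pos {t r a b : ℝ} (ht : 0 < t) (hr : 0 < r) (htb : t < b) (hab : a < b) :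
    0 < paretoMeasure t r (Ioo a b) := by
  rw [paretoMeasure, withDensity_apply _ measurableSet_Ioo,
    setLIntegral_pos_iff (f := paretoPDF t r) (measurable_paretoPDFReal t r).ennreal_ofReal]
  have hsub : Ioo (max t a) b ⊆ Function.support (paretoPDF t r) ∩ Ioo a b := fun x hx =>
    ⟨(ENNReal.ofReal_pos.2 (paretoPDFReal_pos ht hr ((le_max_left t a).trans hx.1.le))).ne',
      (le_max_right t a).trans_lt hx.1, hx.2⟩
  exact lt_of_lt_of_le (by simp [htb, hab]) (measure_mono hsub)

lemma mem_support_paretoMeasure {t r y : ℝ} (ht : 0 < t) (hr : 0 < r) (hy : t < y) :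
    y ∈ (paretoMeasure t r).support := by
  refine (Measure.mem_support_iff_forall y).2 fun U hU => ?_
  obtain ⟨a, b, hab, hsub⟩ := mem_nhds_iff_exists_Ioo_subset.1 hU
  exact (paretoMeasure_Ioo_pos ht hr (hy.trans hab.2) (hab.1.trans hab.2)).trans_le
    (measure_mono hsub)

lemma paretoMeasure_Iic_ne_zero {t r y : ℝ} (ht : 0 < t) (hr : 0 < r) (hy : t < y) :
    paretoMeasure t r (Iic y) ≠ 0 :=
  ((paretoMeasure_Ioo_pos ht hr hy hy).trans_le
    (measure_mono (Ioo_subset_Iio_self.trans Iio_subset_Iic_self))).ne'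

lemma paretoMeasure_Ioi_ne_zero {t r y : ℝ} (ht : 0 < t) (hr : 0 < r) (hy : t < y) :
    paretoMeasure t r (Ioi y) ≠ 0 :=
  ((paretoMeasure_Ioo_pos ht hr (hy.trans (lt_add_one y)) (lt_add_one y)).trans_le
    (measure_mono Ioo_subset_Ioi_self)).ne'

lemma truncPareto_eq_cond_Iic (α y : ℝ) :
    truncPareto α y = cond (paretoMeasure 1 α) (Iic y) := by
  have hset : (Icc 1 y : Set ℝ) =ᵐ[paretoMeasure 1 α] Iic y := by
    filter_upwards [ae_le_paretoMeasure 1 α] with x hx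
    exact propext ⟨fun h => h.2, fun h => ⟨hx, h⟩⟩
  rw [truncPareto, ProbabilityTheory.cond, ProbabilityTheory.cond, measure_congr hset,
    Measure.restrict_congr_set hset]

instance (α y : ℝ) : NullSingletonClass (truncPareto α y) :=
  ⟨fun _ => cond_absolutelyContinuous (measure_singleton _)⟩

variable {α y : ℝ}

lemma isProbabilityMeasure_truncPareto (hα : 0 < α) (hy : 1 < y) :
    IsProbabilityMeasure (truncPareto α y) := by
  have := isProbabilityMeasure_paretoMeasure one_pos hα
  rw [truncPareto_eq_cond_Iic]
  exact cond_isProbabilityMeasure (paretoMeasure_Iic_ne_zero one_pos hα hy)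

lemma memLp_truncPareto (hα : 0 < α) (hy : 1 < y) (p : ENNReal) :
    MemLp (fun t => t) p (truncPareto α y) := by
  have := isProbabilityMeasure_truncPareto hα hy
  refine MemLp.of_bound aestronglyMeasurable_id y ?_
  filter_upwards [ae_cond_mem (μ := paretoMeasure 1 α) (measurableSet_Icc (a := 1) (b := y))]
    with x hx
  rw [Real.norm_eq_abs, abs_of_nonneg (zero_le_one.trans hx.1)]
  exact hx.2

lemma variance_truncPareto_pos (hα : 0 < α) (hy : 1 < y) :
    0 < variance (fun t => t) (truncPareto α y) :=
  have := isProbabilityMeasure_truncPareto hα hy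
  variance_pos_of_nullSingletonClass (memLp_truncPareto hα hy 2)

lemma setIntegral_Icc_paretoMeasure {t r y : ℝ} (ht : 0 ≤ t) (hr : 0 ≤ r) (hy : t ≤ y)
    (f : ℝ → ℝ) :
    ∫ x in Icc t y, f x ∂paretoMeasure t r = ∫ x in t..y, r * t ^ r * x ^ (-(r + 1)) * f x := by
  have hm : Measurable (paretoPDF t r) := (measurable_paretoPDFReal t r).ennreal_ofReal
  rw [paretoMeasure, setIntegral_withDensity_eq_setIntegral_toReal_smul hm
    (ae_of_all _ fun _ => ENNReal.ofReal_lt_top) _ measurableSet_Icc, integral_Icc_eq_integral_Ioc,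
    intervalIntegral.integral_of_le hy]
  refine setIntegral_congr_fun measurableSet_Ioc fun x hx => ?_
  rw [paretoPDF, ENNReal.toReal_ofReal (paretoPDFReal_nonneg ht hr x), paretoPDFReal,
    if_pos hx.1.le, smul_eq_mul]

lemma setIntegral_rpow_paretoMeasure (hα : 0 < α) (hy : 1 ≤ y) (q : ℝ) :
    ∫ x in Icc 1 y, x ^ q ∂paretoMeasure 1 α
      = if α = q then α * Real.log y else (1 - y ^ (q - α)) / (1 - q / α) := by
  have h0 : (0 : ℝ) ∉ uIcc 1 y := fun h => by
    rw [uIcc_of_le hy] at h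
    exact one_pos.not_ge h.1
  have hpow : ∫ x in (1 : ℝ)..y, α * 1 ^ α * x ^ (-(α + 1)) * x ^ q
      = α * ∫ x in (1 : ℝ)..y, x ^ (q - α - 1) := by
    rw [← intervalIntegral.integral_const_mul]
    refine intervalIntegral.integral_congr fun x hx => ?_
    rw [uIcc_of_le hy] at hx
    have hx0 : 0 < x := one_pos.trans_le hx.1
    simp only [Real.one_rpow, mul_one]
    rw [mul_assoc, ← Real.rpow_add hx0]
    ring_nf
  rw [setIntegral_Icc_paretoMeasure zero_le_one hα.le hy, hpow]
  split_ifs with h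
  · rw [h, sub_self, zero_sub]
    simp only [Real.rpow_neg_one]
    rw [integral_inv h0, div_one]
  · have hq : q - α ≠ 0 := sub_ne_zero.2 (Ne.symm h)
    have hq' : α - q ≠ 0 := sub_ne_zero.2 h
    rw [integral_rpow (Or.inr ⟨fun h' => hq (by linarith), h0⟩), sub_add_cancel, Real.one_rpow]
    field_simp
    ring

lemma measureReal_paretoMeasure_Icc (hα : 0 < α) (hy : 1 ≤ y) :
    (paretoMeasure 1 α).real (Icc 1 y) = 1 - y ^ (-α) := by
  simpa [hα.ne'] using setIntegral_rpow_paretoMeasure hα hy 0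

lemma integral_rpow_truncPareto (hα : 0 < α) (hy : 1 ≤ y) (q : ℝ) :
    ∫ x, x ^ q ∂truncPareto α y = (1 - y ^ (-α))⁻¹ *
      if α = q then α * Real.log y else (1 - y ^ (q - α)) / (1 - q / α) := by
  rw [truncPareto, ProbabilityTheory.cond, integral_smul_measure,
    setIntegral_rpow_paretoMeasure hα hy, ENNReal.toReal_inv, ← measureReal_def,
    measureReal_paretoMeasure_Icc hα hy, smul_eq_mul]

lemma integral_truncPareto (hα : 0 < α) (hy : 1 ≤ y) :
    ∫ t, t ∂truncPareto α y = (1 - y ^ (-α))⁻¹ *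
      if α = 1 then Real.log y else (1 - y ^ (1 - α)) / (1 - 1 / α) := by
  have h := integral_rpow_truncPareto hα hy 1
  simp only [Real.rpow_one] at h
  rw [h]
  split_ifs with h1
  · rw [h1, one_mul]
  · rfl

lemma trimmedMean_eq_mul_integral (hα : 0 < α) (hy : 1 ≤ y) {n k : ℕ} (hkn : k ≤ n) :
    trimmedMean α n k y = (n - k : ℕ) * ∫ t, t ∂truncPareto α y := by
  rw [trimmedMean, integral_truncPareto hα hy, Nat.cast_sub hkn, div_eq_mul_inv, mul_assoc]

lemma variance_truncPareto (hα : 0 < α) (hy : 1 < y) :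
    variance (fun t => t) (truncPareto α y) = (1 - y ^ (-α))⁻¹ *
        (if α = 2 then α * Real.log y else (1 - y ^ (2 - α)) / (1 - 2 / α))
      - ((1 - y ^ (-α))⁻¹ *
        if α = 1 then Real.log y else (1 - y ^ (1 - α)) / (1 - 1 / α)) ^ 2 := by
  have := isProbabilityMeasure_truncPareto hα hy
  have hsq := integral_rpow_truncPareto hα hy.le 2
  simp only [Real.rpow_two] at hsq
  rw [variance_eq_sub (memLp_truncPareto hα hy 2), integral_truncPareto hα hy.le, ← hsq]
  rfl

lemma variance_truncPareto_one (hy : 1 < y) :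
    variance (fun t => t) (truncPareto 1 y) = y * (1 - y * Real.log y ^ 2 / (y - 1) ^ 2) := by
  have hy1 : y - 1 ≠ 0 := (sub_pos.2 hy).ne'
  have hinv : 1 - y ^ (-1 : ℝ) = (y - 1) / y := by
    rw [Real.rpow_neg_one]
    field_simp
  have hpow : y ^ ((2 : ℝ) - 1) = y := by norm_num
  rw [variance_truncPareto one_pos hy, if_neg (by norm_num), if_pos rfl, hinv, hpow]
  field_simp
  ring

lemma variance_truncPareto_two (hy : 1 < y) :
    variance (fun t => t) (truncPareto 2 y)
      = 2 * (y ^ 2 / (y ^ 2 - 1)) * (Real.log y - 2 * ((y - 1) / (y + 1))) := by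
  have hy1 : y - 1 ≠ 0 := (sub_pos.2 hy).ne'
  have hyp : y + 1 ≠ 0 := by positivity
  have hfac : y ^ 2 - 1 = (y - 1) * (y + 1) := by ring
  have hinv : 1 - y ^ (-2 : ℝ) = (y - 1) * (y + 1) / y ^ 2 := by
    rw [Real.rpow_neg (by positivity), Real.rpow_two, ← hfac]
    field_simp
  have hinv' : 1 - y ^ ((1 : ℝ) - 2) = (y - 1) / y := by
    rw [show (1 : ℝ) - 2 = -1 by norm_num, Real.rpow_neg_one]
    field_simp
  rw [variance_truncPareto two_pos hy, if_pos rfl, if_neg (by norm_num), hinv, hinv', hfac]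
  field_simp
  ring

lemma trimmedVar_eq_mul_variance (hα : 0 < α) (hy : 1 < y) {n k : ℕ} (hkn : k ≤ n) :
    trimmedVar α n k y = (n - k : ℕ) * variance (fun t => t) (truncPareto α y) := by
  rw [trimmedVar, Nat.cast_sub hkn]
  split_ifs with h1 h2
  · rw [h1, variance_truncPareto_one hy]
    ring
  · rw [h2, variance_truncPareto_two hy]
    ring
  · rw [variance_truncPareto hα hy, if_neg h1, if_neg h2]
    generalize 1 - 1 / α = d
    ring

end Pareto

lemma truncParetoSumLaw_eq_iidSumLaw (α y : ℝ) (m : ℕ) :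
    truncParetoSumLaw α y m = iidSumLaw (truncPareto α y) m :=
  rfl

lemma isCondLawAt_trimmedSum_iff_eq_truncParetoSumLaw {Ω : Type*} [MeasurableSpace Ω]
    {P : Measure Ω} [IsProbabilityMeasure P] {α : ℝ} (hα : 0 < α) {k : ℕ} (hk : 1 ≤ k)
    {X : ℕ → Ω → ℝ} (hX : ∀ i, Measurable (X i)) (hindep : iIndepFun X P)
    (hlaw : ∀ i, P.map (X i) = paretoMeasure 1 α) {n : ℕ} (hkn : k ≤ n) {y : ℝ} (hy : 1 < y)
    {ν : Measure ℝ} :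
    IsCondLawAt P (trimmedSum X n k) (orderStat X n (n - k + 1)) y ν
      ↔ ν = truncParetoSumLaw α y (n - k) := by
  have := isProbabilityMeasure_paretoMeasure one_pos hα
  rw [truncParetoSumLaw_eq_iidSumLaw, truncPareto_eq_cond_Iic]
  exact isCondLawAt_trimmedSum_iff hX hindep hlaw hk hkn (mem_support_paretoMeasure one_pos hα hy)
    (paretoMeasure_Iic_ne_zero one_pos hα hy) (paretoMeasure_Ioi_ne_zero one_pos hα hy)

theorem proposition1 {Ω : Type*} [MeasurableSpace Ω] (P : Measure Ω) [IsProbabilityMeasure P]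
    (α : ℝ) (hα : 0 < α) (k : ℕ) (hk : 1 ≤ k)
    (X : ℕ → Ω → ℝ) (hmeas : ∀ i, Measurable (X i)) (hindep : iIndepFun X P)
    (hlaw : ∀ i, P.map (X i) = paretoMeasure 1 α) :
    -- the regular conditional distribution is the law of a sum of iid truncated Pareto variables
    (∀ n : ℕ, k ≤ n →
      ∀ᵐ y ∂(P.map (orderStat X n (n - k + 1))),
        condDistrib (trimmedSum X n k) (orderStat X n (n - k + 1)) P y
          = truncParetoSumLaw α y (n - k)) ∧
    -- the same at every `y > 1`
    (∀ n : ℕ, k ≤ n → ∀ y : ℝ, 1 < y → ∀ ν : Measure ℝ,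
      IsCondLawAt P (trimmedSum X n k) (orderStat X n (n - k + 1)) y ν
        ↔ ν = truncParetoSumLaw α y (n - k)) ∧
    -- conditional mean and variance in closed form
    (∀ n : ℕ, k ≤ n → ∀ y : ℝ, 1 < y → ∀ ν : Measure ℝ,
      IsCondLawAt P (trimmedSum X n k) (orderStat X n (n - k + 1)) y ν →
        MemLp (fun t : ℝ => t) 2 ν ∧
        ∫ t, t ∂ν = trimmedMean α n k y ∧
        variance (fun t : ℝ => t) ν = trimmedVar α n k y ∧
        (k < n → 0 < trimmedVar α n k y)) ∧
    -- asymptotic normality, for standardized sums and uniformly for the distribution functions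
    (∀ y : ℝ, 1 < y → ∀ ν : ℕ → Measure ℝ,
      (∀ n : ℕ, k ≤ n →
        IsCondLawAt P (trimmedSum X n k) (orderStat X n (n - k + 1)) y (ν n)) →
      (∀ x : ℝ,
        Tendsto
          (fun n : ℕ =>
            (ν n).real {t : ℝ | (t - trimmedMean α n k y) / Real.sqrt (trimmedVar α n k y) ≤ x})
          atTop (𝓝 ((gaussianReal 0 1).real (Iic x)))) ∧
      (∀ ε : ℝ, 0 < ε → ∀ᶠ n : ℕ in atTop, ∀ x : ℝ,
        |(ν n).real (Iic x)
          - (gaussianReal (trimmedMean α n k y) (trimmedVar α n k y).toNNReal).real (Iic x)| < ε)) := by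
  have := isProbabilityMeasure_paretoMeasure one_pos hα
  have hiff {n : ℕ} (hn : k ≤ n) {y : ℝ} (hy : 1 < y) (ν : Measure ℝ) :=
    isCondLawAt_trimmedSum_iff_eq_truncParetoSumLaw hα hk hmeas hindep hlaw hn hy (ν := ν)
  refine ⟨fun n hn => ?_, fun n hn y hy ν => hiff hn hy ν, fun n hn y hy ν hν => ?_,
    fun y hy ν hν => ⟨fun x => ?_, fun ε hε => ?_⟩⟩
  · simp only [truncParetoSumLaw_eq_iidSumLaw, truncPareto_eq_cond_Iic]
    exact condDistrib_trimmedSum_ae_eq hmeas hindep hlaw hk hn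
  all_goals have := isProbabilityMeasure_truncPareto hα hy
  · have hL := memLp_truncPareto hα hy 2
    rw [(hiff hn hy ν).1 hν, trimmedMean_eq_mul_integral hα hy.le hn,
      trimmedVar_eq_mul_variance hα hy hn, truncParetoSumLaw_eq_iidSumLaw]
    exact ⟨memLp_iidSumLaw hL _, integral_iidSumLaw (hL.integrable one_le_two) _,
      variance_iidSumLaw hL _, fun hkn =>
        mul_pos (Nat.cast_pos.2 (Nat.sub_pos_of_lt hkn)) (variance_truncPareto_pos hα hy)⟩
  · refine ((tendsto_iidSumLaw_real_setOf_standardized_le (variance_truncPareto_pos hα hy) x).comp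
      (tendsto_sub_atTop_nat k)).congr' ?_
    filter_upwards [eventually_ge_atTop k] with n hn
    rw [(hiff hn hy _).1 (hν n hn), trimmedMean_eq_mul_integral hα hy.le hn,
      trimmedVar_eq_mul_variance hα hy hn]
    rfl
  · filter_upwards [(tendsto_sub_atTop_nat k).eventually
      (eventually_forall_abs_iidSumLaw_real_Iic_sub_lt (variance_truncPareto_pos hα hy) hε),
      eventually_ge_atTop k] with n hclt hn
    rwa [(hiff hn hy _).1 (hν n hn), trimmedMean_eq_mul_integral hα hy.le hn,
      trimmedVar_eq_mul_variance hα hy hn]
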